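/- Let $L$ be a positive integer and let $V_L$ be the (countable) set of vectors $(u_1,\dots,u_L)$ of positive integers with $u_1<u_2<\dots<u_L$. List it as $V_L=\{v_j : j\ge 1\}$ and define $s:\{1,2,\dots\}\to V_L$ by $s(2^{j-1}+i2^j)=v_j$ for $j\ge 1$, $i\ge 0$. Let $(r_n)_{n\ge 1}$ be a nondecreasing sequence of positive integers with $r_n>L$ for all $n$. Construct a rank-one transformation $T$ by cutting and stacking as follows. Let $C_1=[0,1)$, a column of height $h_1=1$. Given the column $C_n$ of height $h_n$, write $s(n)=(u_1,\dots,u_L)$ and $\sigma=u_1+\dots+u_L$. Cut $C_n$ into $r_n$ subcolumns of equal width, numbered $1,\dots,r_n$ from left to right; place $(2L+1)h_n+\sigma$ spacers on the $i$-th subcolumn for $1\le i\le r_n-L-1$, place $h_n+u_d$ spacers on the $(r_n-L-1+d)$-th subcolumn for $1\le d\le L$, and none on the last one. Stack each subcolumn on top of its left neighbour to form a column of height $g_n=r_nh_n+(r_n-L-1)((2L+1)h_n+\sigma)+(Lh_n+\sigma)$, and place $g_n$ further spacers on top to form $C_{n+1}$, of height $h_{n+1}=2g_n$. (Spacers are new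 half-open intervals of $\mathbb R$ of the same width as the levels of the new column, chosen disjoint from each other and from $C_n$.) Let $X=\bigcup_n C_n\subset\mathbb R$, let $\mu$ be Lebesgue measure on $X$, and let $T$ be the transformation of $X$ that translates each level of each $C_n$, other than the top one, onto the level above it. Let $V_L^*$ be the family of all transformations $T$ obtained in this way. Theorem. Let $k$ and $L$ be integers with $1<k\le L$ and let $T\in V_L^*$ be constructed with the sequence $(r_n)$. Then the $k$-fold Cartesian product $T\times\dots\times T$ is ergodic on $X^k$ with respect to the product measure $\mu^k$ if and only if $$\sum_{i=1}^{\infty}\left(\frac{1}{r_i}\right)^k=\infty .$$ -/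

import Mathlib

open MeasureTheory

namespace CuttingStacking

/-- The set `V_L` of vectors `u_1 < u_2 < ⋯ < u_L` of positive integers. -/
abbrev SpacerVector (L : ℕ) : Type :=
  {u : Fin L → ℕ // (∀ d, 0 < u d) ∧ StrictMono u}

section Stack

variable {L : ℕ} (r h : ℕ) (u : SpacerVector L)

/-- A column of height `h` is cut into `r` subcolumns, numbered `0, …, r - 1` from left to right.
`spacerCount r h u i` is the number of spacers placed on subcolumn `i`, before the subcolumns are
stacked: `(2L+1)h + σ` with `σ = u_1 + ⋯ + u_L` on each of the first `r - L - 1` subcolumns,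
`h + u_1, …, h + u_L` on the next `L` subcolumns, and none on the last one. -/
def spacerCount (i : ℕ) : ℕ :=
  if i + L + 1 < r then (2 * L + 1) * h + ∑ d, u.1 d
  else if hd : i + L + 1 - r < L then h + u.1 ⟨i + L + 1 - r, hd⟩
  else 0

/-- The subcolumns (with their spacers) are stacked, each on top of its left neighbour.
`copyBase r h u i` is the height at which the bottom of subcolumn `i` ends up. -/
def copyBase (i : ℕ) : ℕ :=
  ∑ j ∈ Finset.range i, (h + spacerCount r h u j)

/-- The height `g` of the stack of all `r` subcolumns with their spacers. -/
def stackHeight : ℕ := copyBase r h u r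

theorem stackHeight_eq (hr : L < r) :
    stackHeight r h u =
      r * h + (r - L - 1) * ((2 * L + 1) * h + ∑ d, u.1 d) + (L * h + ∑ d, u.1 d) := by
  obtain ⟨m, rfl⟩ : ∃ m, r = m + (L + 1) := ⟨r - (L + 1), by omega⟩
  have h1 : ∑ j ∈ Finset.range m, spacerCount (m + (L + 1)) h u j
      = m * ((2 * L + 1) * h + ∑ d, u.1 d) := by
    rw [Finset.sum_congr rfl (g := fun _ => (2 * L + 1) * h + ∑ d, u.1 d)]
    · simp
    · intro j hj
      have := Finset.mem_range.1 hj
      simp only [spacerCount]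
      rw [if_pos (by omega)]
  have h2 : ∑ j ∈ Finset.range L, spacerCount (m + (L + 1)) h u (m + j)
      = L * h + ∑ d, u.1 d := by
    rw [Finset.sum_range]
    rw [Finset.sum_congr rfl (g := fun d : Fin L => h + u.1 d)]
    · simp [Finset.sum_add_distrib]
    · intro d _
      have hd := d.2
      have e : m + (d : ℕ) + L + 1 - (m + (L + 1)) = d := by omega
      simp only [spacerCount]
      rw [if_neg (by omega), dif_pos (by omega)]
      have e2 : (⟨m + d + L + 1 - (m + (L + 1)), by omega⟩ : Fin L) = d := Fin.ext e
      rw [e2]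
  have h3 : spacerCount (m + (L + 1)) h u (m + L) = 0 := by
    simp only [spacerCount]
    rw [if_neg (by omega), dif_neg (by omega)]
  have e : m + (L + 1) - L - 1 = m := by omega
  rw [stackHeight, copyBase, Finset.sum_add_distrib,
    Finset.sum_range_add (spacerCount (m + (L + 1)) h u) m (L + 1),
    Finset.sum_range_succ _ L, h1, h2, h3, e]
  simp [add_assoc]

end Stack

/-- The parameters of the construction. Stages are numbered from `0`: `r n` and the `n`-th column
are what is called `r_{n+1}` and `C_{n+1}` when stages are numbered from `1`; `v` lists the
set `V_L`, its `j`-th entry being `v_{j+1}`. -/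
structure Params (L : ℕ) where
  r : ℕ → ℕ
  r_mono : Monotone r
  lt_r : ∀ n, L < r n
  v : ℕ → SpacerVector L
  v_surjective : Function.Surjective v

namespace Params

variable {L : ℕ} (P : Params L)

/-- The spacer vector used at each stage. With both stages and list entries numbered from `1`, it
is `v_j` at the stages `2^(j-1) + i * 2^j`, `i = 0, 1, 2, …`. -/
def s (n : ℕ) : SpacerVector L := P.v (padicValNat 2 (n + 1))

theorem s_eq (n j i : ℕ) (h : n + 1 = 2 ^ j + i * 2 ^ (j + 1)) : P.s n = P.v j := by
  have e : n + 1 = 2 ^ j * (1 + 2 * i) := by rw [h]; ring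
  have h2 : padicValNat 2 (1 + 2 * i) = 0 := padicValNat.eq_zero_of_not_dvd (by omega)
  rw [s, e, padicValNat.mul (by positivity) (by omega), h2, padicValNat.prime_pow, add_zero]

/-- The height `h` of the `n`-th column. The stack of height `g` built from the `n`-th column
receives `g` further spacers on its top. -/
def height : ℕ → ℕ
  | 0 => 1
  | n + 1 => 2 * stackHeight (P.r n) (height n) (P.s n)

/-- The width of the levels of the `n`-th column. -/
noncomputable def width : ℕ → ℝ
  | 0 => 1
  | n + 1 => width n / P.r n

/-- The height, in column `n + 1`, of the bottom of the `i`-th subcolumn of column `n`. -/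
def base (n i : ℕ) : ℕ := copyBase (P.r n) (P.height n) (P.s n) i

end Params

/-- The family `V_L^*` of cutting and stacking constructions: the parameters, together with a
choice of the intervals that serve as levels. Level `j` (counted from the bottom, from `0`) of
column `n` is the interval `[left n j, left n j + width n)`. Column `0` is `[0, 1)`. Level `j` of
the `i`-th subcolumn of column `n` becomes level `base n i + j` of column `n + 1`. The remaining
levels of column `n + 1` are spacers: arbitrary intervals, such that the levels of each column
are pairwise disjoint. -/
structure VStar (L : ℕ) extends Params L where
  left : ℕ → ℕ → ℝ
  left_zero : left 0 0 = 0
  left_copy : ∀ n i j, i < r n → j < toParams.height n →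
    left (n + 1) (toParams.base n i + j) = left n j + i * toParams.width (n + 1)
  disjoint_levels : ∀ n j j', j < toParams.height n → j' < toParams.height n → j ≠ j' →
    Disjoint (Set.Ico (left n j) (left n j + toParams.width n))
      (Set.Ico (left n j') (left n j' + toParams.width n))

namespace VStar

variable {L : ℕ} (D : VStar L)

/-- Level `j` of column `n`. -/
def level (n j : ℕ) : Set ℝ := Set.Ico (D.left n j) (D.left n j + D.width n)

/-- The space `X`, the union of all columns. -/
def space : Set ℝ := ⋃ n, ⋃ j ∈ Finset.range (D.height n), D.level n j

/-- Lebesgue measure on `X`. -/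
noncomputable def μ : Measure ℝ := volume.restrict D.space

open Classical in
/-- The transformation: each level of a column, except the top one, is translated onto the level
above it (see `T_eq`). Points outside `X`, a null set for `D.μ`, are left fixed. -/
noncomputable def T (x : ℝ) : ℝ :=
  if h : ∃ p : ℕ × ℕ, p.2 + 1 < D.height p.1 ∧ x ∈ D.level p.1 p.2 then
    x + (D.left h.choose.1 (h.choose.2 + 1) - D.left h.choose.1 h.choose.2)
  else x

theorem exists_copy {n j : ℕ} {x : ℝ} (hj : j < D.height n) (hx : x ∈ D.level n j) :
    ∃ i < D.r n, x ∈ D.level (n + 1) (D.base n i + j) := by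
  have hr : 0 < D.r n := lt_of_le_of_lt (Nat.zero_le _) (D.lt_r n)
  have hr' : (0 : ℝ) < D.r n := by exact_mod_cast hr
  obtain ⟨hx1, hx2⟩ := hx
  have hw : 0 < D.width n := by linarith
  have hw' : D.width (n + 1) = D.width n / D.r n := rfl
  have hwp : 0 < D.width (n + 1) := by rw [hw']; positivity
  have hd : 0 ≤ (x - D.left n j) / D.width (n + 1) := div_nonneg (by linarith) hwp.le
  have hfl := Nat.floor_le hd
  have hlt := Nat.lt_floor_add_one ((x - D.left n j) / D.width (n + 1))
  rw [le_div_iff₀ hwp] at hfl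
  rw [div_lt_iff₀ hwp] at hlt
  have hi : ⌊(x - D.left n j) / D.width (n + 1)⌋₊ < D.r n := by
    rw [Nat.floor_lt hd, div_lt_iff₀ hwp, hw', mul_div_cancel₀ _ hr'.ne']
    linarith
  refine ⟨_, hi, ?_⟩
  simp only [level, Set.mem_Ico]
  rw [D.left_copy n _ j hi hj]
  constructor <;> linarith

theorem base_add_lt {n i j : ℕ} (hi : i < D.r n) (hj : j < D.height n) :
    D.base n i + j < D.height (n + 1) := by
  have h1 : D.base n i + D.height n ≤ stackHeight (D.r n) (D.height n) (D.s n) := by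
    calc D.base n i + D.height n ≤ copyBase (D.r n) (D.height n) (D.s n) (i + 1) := by
          rw [copyBase, Finset.sum_range_succ]
          simp only [Params.base, copyBase]
          omega
      _ ≤ _ := Finset.sum_le_sum_of_subset (Finset.range_mono hi)
  have h2 : D.height (n + 1) = 2 * stackHeight (D.r n) (D.height n) (D.s n) := rfl
  omega

theorem exists_later {n j : ℕ} {x : ℝ} (hj : j + 1 < D.height n) (hx : x ∈ D.level n j) (m : ℕ) :
    ∃ j', j' + 1 < D.height (n + m) ∧ x ∈ D.level (n + m) j' ∧
      D.left (n + m) (j' + 1) - D.left (n + m) j' = D.left n (j + 1) - D.left n j := by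
  induction m with
  | zero => exact ⟨j, hj, hx, rfl⟩
  | succ m ih =>
    obtain ⟨j', h1, h2, h3⟩ := ih
    obtain ⟨i, hi, hxi⟩ := D.exists_copy (by omega) h2
    refine ⟨D.base (n + m) i + j', ?_, hxi, ?_⟩
    · have := D.base_add_lt hi h1
      rw [← add_assoc n m 1]
      omega
    · rw [← h3, ← add_assoc n m 1, add_assoc (D.base (n + m) i), D.left_copy _ _ _ hi h1,
        D.left_copy _ _ _ hi (by omega)]
      ring

/-- On every level of every column, except the top one, `T` is the translation onto the level
above it. -/
theorem T_eq {n j : ℕ} {x : ℝ} (hj : j + 1 < D.height n) (hx : x ∈ D.level n j) :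
    D.T x = x + (D.left n (j + 1) - D.left n j) := by
  have h : ∃ p : ℕ × ℕ, p.2 + 1 < D.height p.1 ∧ x ∈ D.level p.1 p.2 := ⟨(n, j), hj, hx⟩
  rw [T, dif_pos h]
  obtain ⟨a, ha, hxa, ea⟩ := D.exists_later h.choose_spec.1 h.choose_spec.2 n
  obtain ⟨b, hb, hxb, eb⟩ := D.exists_later hj hx h.choose.1
  rw [add_comm h.choose.1 n] at ha hxa ea
  have hab : a = b := by
    by_contra hne
    exact Set.disjoint_left.1 (D.disjoint_levels _ a b (by omega) (by omega) hne) hxa hxb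
  subst hab
  rw [← ea, ← eb]

/-- The `k`-fold Cartesian product of `T`. -/
noncomputable def prodT (k : ℕ) (x : Fin k → ℝ) : Fin k → ℝ := fun i => D.T (x i)

/-- The `k`-fold product measure. -/
noncomputable def prodMeasure (k : ℕ) : Measure (Fin k → ℝ) := Measure.pi fun _ => D.μ

end VStar

end CuttingStacking

namespace CuttingStacking

namespace VStar

variable {L : ℕ} (D : VStar L) {k : ℕ}

/-! Divergence gives ergodicity. Let `A` be invariant, and let `a`, `b` be tuples of levels of one
column. As `k ≤ L`, some spacer vector `u` has entries realizing the differences `a j - b j` up to a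
common constant (`exists_spacerVector`). Copies of the two boxes with equal index tuples keep these
differences in every later column. At each stage using `u`, one copy of the first box is carried
onto one copy of the second by a power of the product map, so `A` has equal mass in both. This pair
is a proportion `1 / r ^ k` of each box. Such stages recur periodically and `r` is monotone, so the
proportions still have divergent sum along them, and in the limit the densities of `A` in the two
boxes differ by at most `1/2` (`abs_mass_sub_mass_le`). If neither `A` nor its complement were null,
Lebesgue density would give boxes of one column where `A` has density above `3/4` and below `1/4`.

Convergence destroys ergodicity. The last `L + 1` copies in all coordinates at once occupy a
proportion `((L + 1) / r) ^ k` of a box, so from a late column on, a positive part of every box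
never meets this situation. Away from it, positions of copies are rigid: the large spacer blocks and
the empty upper half of each column ensure that level tuples differing by a constant come from level
tuples differing by a constant (`diff_const_of_reach`). The points eventually reachable from `a`, up
to a constant, thus form an invariant set that misses a positive part of the box `b` whenever `b -
a` is not constant. -/

/-! ### Levels and their copies -/

theorem r_pos (n : ℕ) : 0 < D.r n := lt_of_le_of_lt (Nat.zero_le _) (D.lt_r n)

theorem width_succ (n : ℕ) : D.width (n + 1) = D.width n / D.r n := rfl

theorem width_pos (n : ℕ) : 0 < D.width n := by
  induction n with
  | zero => exact one_pos
  | succ n ih =>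
    rw [width_succ]
    exact div_pos ih (by exact_mod_cast D.r_pos n)

theorem base_succ (n i : ℕ) :
    D.base n (i + 1) = D.base n i + (D.height n + spacerCount (D.r n) (D.height n) (D.s n) i) := by
  simp only [Params.base, copyBase, Finset.sum_range_succ]

theorem two_mul_base_add_le {n i j : ℕ} (hi : i < D.r n) (hj : j < D.height n) :
    2 * (D.base n i + j + 1) ≤ D.height (n + 1) := by
  have h1 : D.base n (i + 1) ≤ stackHeight (D.r n) (D.height n) (D.s n) :=
    Finset.sum_le_sum_of_subset (Finset.range_mono hi)
  have h2 : D.height (n + 1) = 2 * stackHeight (D.r n) (D.height n) (D.s n) := rfl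
  rw [base_succ] at h1
  omega

theorem height_pos (n : ℕ) : 0 < D.height n := by
  induction n with
  | zero => exact one_pos
  | succ n ih =>
    have := D.base_add_lt (D.r_pos n) ih
    omega

theorem base_strictMono (n : ℕ) : StrictMono (D.base n) := by
  refine strictMono_nat_of_lt_succ fun i => ?_
  have := D.height_pos n
  rw [base_succ]
  omega

theorem level_subset_level {n i j : ℕ} (hi : i < D.r n) (hj : j < D.height n) :
    D.level (n + 1) (D.base n i + j) ⊆ D.level n j := by
  rintro x ⟨hx1, hx2⟩
  rw [D.left_copy n i j hi hj] at hx1 hx2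
  have hw := D.width_pos (n + 1)
  have hr : (0 : ℝ) < D.r n := by exact_mod_cast D.r_pos n
  have hi' : (i : ℝ) + 1 ≤ D.r n := by exact_mod_cast hi
  have e : D.width n = D.r n * D.width (n + 1) := by
    rw [width_succ]; field_simp
  constructor
  · have : 0 ≤ (i : ℝ) * D.width (n + 1) := by positivity
    linarith
  · have := mul_le_mul_of_nonneg_right hi' hw.le
    rw [e]
    linarith

theorem eq_of_mem_level {n j j' : ℕ} {x : ℝ} (hj : j < D.height n) (hj' : j' < D.height n)
    (hx : x ∈ D.level n j) (hx' : x ∈ D.level n j') : j = j' := by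
  by_contra hne
  exact Set.disjoint_left.1 (D.disjoint_levels n j j' hj hj' hne) hx hx'

theorem measurableSet_level (n j : ℕ) : MeasurableSet (D.level n j) := measurableSet_Ico

theorem measurableSet_space : MeasurableSet D.space :=
  .iUnion fun n => .biUnion (Set.to_countable _) fun j _ => D.measurableSet_level n j

theorem level_subset_space {n j : ℕ} (hj : j < D.height n) : D.level n j ⊆ D.space := fun _ hx =>
  Set.mem_iUnion.2 ⟨n, Set.mem_iUnion₂.2 ⟨j, Finset.mem_range.2 hj, hx⟩⟩

theorem mem_space {x : ℝ} : x ∈ D.space ↔ ∃ n, ∃ j < D.height n, x ∈ D.level n j := by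
  simp [space]

theorem volume_level (n j : ℕ) : volume (D.level n j) = ENNReal.ofReal (D.width n) := by
  rw [level, Real.volume_Ico]
  congr 1
  ring

/-- Points of the space eventually lie in the lower half of the columns. -/
theorem eventually_mem_level {x : ℝ} (hx : x ∈ D.space) :
    ∀ᶠ n in Filter.atTop, ∃ j, j + 1 < D.height n ∧ x ∈ D.level n j := by
  obtain ⟨n, j, hj, hxj⟩ := D.mem_space.1 hx
  refine Filter.eventually_atTop.2 ⟨n + 1, fun m hm => ?_⟩
  induction m, hm using Nat.le_induction with
  | base =>
    obtain ⟨i, hi, hxi⟩ := D.exists_copy hj hxj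
    have := D.two_mul_base_add_le hi hj
    exact ⟨_, by omega, hxi⟩
  | succ m _ ih =>
    obtain ⟨j, hj, hxj⟩ := ih
    obtain ⟨i, hi, hxi⟩ := D.exists_copy (by omega) hxj
    have := D.base_add_lt hi hj
    exact ⟨_, by omega, hxi⟩

theorem T_mem_level {n j : ℕ} {x : ℝ} (hj : j + 1 < D.height n) (hx : x ∈ D.level n j) :
    D.T x ∈ D.level n (j + 1) := by
  rw [D.T_eq hj hx]
  obtain ⟨h1, h2⟩ := hx
  constructor <;> linarith

theorem T_of_notMem {x : ℝ} (hx : x ∉ D.space) : D.T x = x := by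
  rw [T, dif_neg]
  rintro ⟨p, hp, hxp⟩
  exact hx (D.level_subset_space (by omega) hxp)

theorem T_mem_space_iff {x : ℝ} : D.T x ∈ D.space ↔ x ∈ D.space := by
  by_cases hx : x ∈ D.space
  · obtain ⟨n, j, hj, hxj⟩ := (D.eventually_mem_level hx).exists
    simp only [hx, iff_true]
    exact D.level_subset_space hj (D.T_mem_level hj hxj)
  · rw [D.T_of_notMem hx]

/-! ### Boxes of levels in the product -/

/-- The box in the `k`-fold product whose sides are the levels `p j` of column `n`. -/
def box (n : ℕ) (p : Fin k → ℕ) : Set (Fin k → ℝ) := Set.univ.pi fun j => D.level n (p j)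

theorem mem_box {n : ℕ} {p : Fin k → ℕ} {x : Fin k → ℝ} :
    x ∈ D.box n p ↔ ∀ j, x j ∈ D.level n (p j) := Set.mem_univ_pi

theorem measurableSet_box (n : ℕ) (p : Fin k → ℕ) : MeasurableSet (D.box n p) :=
  .univ_pi fun j => D.measurableSet_level n (p j)

theorem volume_box (n : ℕ) (p : Fin k → ℕ) :
    volume (D.box n p) = ENNReal.ofReal (D.width n ^ k) := by
  rw [box, volume_pi_pi]
  simp [volume_level, ENNReal.ofReal_pow (D.width_pos n).le]

theorem box_subset_space {n : ℕ} {p : Fin k → ℕ} (hp : ∀ j, p j < D.height n) :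
    D.box n p ⊆ Set.univ.pi fun _ => D.space :=
  Set.pi_mono fun j _ => D.level_subset_space (hp j)

theorem eq_of_mem_box {n : ℕ} {p p' : Fin k → ℕ} {x : Fin k → ℝ} (hp : ∀ j, p j < D.height n)
    (hp' : ∀ j, p' j < D.height n) (hx : x ∈ D.box n p) (hx' : x ∈ D.box n p') : p = p' :=
  funext fun j => D.eq_of_mem_level (hp j) (hp' j) (D.mem_box.1 hx j) (D.mem_box.1 hx' j)

theorem exists_copy_box {n : ℕ} {p : Fin k → ℕ} {x : Fin k → ℝ} (hp : ∀ j, p j < D.height n)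
    (hx : x ∈ D.box n p) :
    ∃ i : Fin k → Fin (D.r n), x ∈ D.box (n + 1) fun j => D.base n (i j) + p j := by
  choose i hi hxi using fun j => D.exists_copy (hp j) (D.mem_box.1 hx j)
  exact ⟨fun j => ⟨i j, hi j⟩, D.mem_box.2 hxi⟩

theorem copy_lt {n : ℕ} {p : Fin k → ℕ} (hp : ∀ j, p j < D.height n) (i : Fin k → Fin (D.r n))
    (j : Fin k) : D.base n (i j) + p j < D.height (n + 1) :=
  D.base_add_lt (i j).2 (hp j)

theorem box_subset_box {n : ℕ} {p : Fin k → ℕ} (hp : ∀ j, p j < D.height n)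
    (i : Fin k → Fin (D.r n)) :
    D.box (n + 1) (fun j => D.base n (i j) + p j) ⊆ D.box n p :=
  Set.pi_mono fun j _ => D.level_subset_level (i j).2 (hp j)

/-- A box is the disjoint union of its copies in the next column. -/
theorem measure_box_eq_sum (ν : Measure (Fin k → ℝ)) {n : ℕ} {p : Fin k → ℕ}
    (hp : ∀ j, p j < D.height n) :
    ν (D.box n p) =
      ∑ i : Fin k → Fin (D.r n), ν (D.box (n + 1) fun j => D.base n (i j) + p j) := by
  have e : D.box n p =
      ⋃ i : Fin k → Fin (D.r n), D.box (n + 1) (fun j => D.base n (i j) + p j) := by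
    refine Set.Subset.antisymm (fun x hx => Set.mem_iUnion.2 (D.exists_copy_box hp hx))
      (Set.iUnion_subset fun i => D.box_subset_box hp i)
  rw [e, measure_iUnion _ fun i => D.measurableSet_box _ _, tsum_fintype]
  intro i i' hne
  refine Set.disjoint_left.2 fun x hx hx' => hne ?_
  have := D.eq_of_mem_box (D.copy_lt hp i) (D.copy_lt hp i') hx hx'
  ext j
  have := congrFun this j
  exact (D.base_strictMono n).injective (by simpa using this)

theorem width_pow_eq (n : ℕ) :
    D.width n ^ k = (D.r n : ℝ) ^ k * D.width (n + 1) ^ k := by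
  have hr : (0 : ℝ) < D.r n := by exact_mod_cast D.r_pos n
  rw [← mul_pow, width_succ, mul_div_cancel₀ _ hr.ne']

theorem prodT_mem_box {n : ℕ} {p : Fin k → ℕ} {x : Fin k → ℝ} (hp : ∀ j, p j + 1 < D.height n)
    (hx : x ∈ D.box n p) : D.prodT k x ∈ D.box n fun j => p j + 1 :=
  D.mem_box.2 fun j => D.T_mem_level (hp j) (D.mem_box.1 hx j)

theorem eventually_mem_box {x : Fin k → ℝ} (hx : ∀ j, x j ∈ D.space) :
    ∀ᶠ n in Filter.atTop, ∃ p : Fin k → ℕ, (∀ j, p j + 1 < D.height n) ∧ x ∈ D.box n p := by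
  filter_upwards [Filter.eventually_all.2 fun j => D.eventually_mem_level (hx j)] with n hn
  choose p hp hxp using hn
  exact ⟨p, hp, D.mem_box.2 hxp⟩

theorem prodMeasure_eq :
    D.prodMeasure k = volume.restrict (Set.univ.pi fun _ => D.space) := by
  rw [volume_pi, Measure.restrict_pi_pi]
  rfl

/-! ### Invariance of the measure -/

theorem tendsto_width (hL : 0 < L) : Filter.Tendsto D.width Filter.atTop (nhds 0) := by
  have h : ∀ n, D.width n ≤ (1 / 2 : ℝ) ^ n := by
    intro n
    induction n with
    | zero => simp [Params.width]
    | succ n ih =>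
      have hr : (2 : ℝ) ≤ D.r n := by exact_mod_cast (by have := D.lt_r n; omega : 2 ≤ D.r n)
      rw [width_succ, pow_succ, mul_one_div]
      exact div_le_div₀ (by positivity) ih (by norm_num) hr
  exact squeeze_zero (fun n => (D.width_pos n).le) h
    (tendsto_pow_atTop_nhds_zero_of_lt_one (by norm_num) (by norm_num))

theorem measurable_T : Measurable D.T := by
  intro B hB
  have e : D.T ⁻¹' B = (⋃ n, ⋃ j, ⋃ _ : j + 1 < D.height n, D.level n j ∩
      (fun x => x + (D.left n (j + 1) - D.left n j)) ⁻¹' B) ∪ (B ∩ D.spaceᶜ) := by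
    ext x
    simp only [Set.mem_preimage, Set.mem_union, Set.mem_iUnion, Set.mem_inter_iff,
      Set.mem_compl_iff, exists_prop]
    constructor
    · intro hx
      by_cases hs : x ∈ D.space
      · obtain ⟨n, j, hj, hxj⟩ := (D.eventually_mem_level hs).exists
        rw [D.T_eq hj hxj] at hx
        exact .inl ⟨n, j, hj, hxj, hx⟩
      · rw [D.T_of_notMem hs] at hx
        exact .inr ⟨hx, hs⟩
    · rintro (⟨n, j, hj, hxj, hx⟩ | ⟨hx, hs⟩)
      · rwa [D.T_eq hj hxj]
      · rwa [D.T_of_notMem hs]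
  rw [e]
  refine .union (.iUnion fun n => .iUnion fun j => .iUnion fun _ => ?_)
    (hB.inter D.measurableSet_space.compl)
  exact (D.measurableSet_level n j).inter (measurable_add_const _ hB)

theorem volume_level_inter_preimage {n j : ℕ} (hj : j + 1 < D.height n) (B : Set ℝ) :
    volume (D.level n j ∩ D.T ⁻¹' B) = volume (D.level n (j + 1) ∩ B) := by
  have e : D.level n j ∩ D.T ⁻¹' B =
      (fun x => x + (D.left n (j + 1) - D.left n j)) ⁻¹' (D.level n (j + 1) ∩ B) := by
    ext x
    simp only [Set.mem_inter_iff, Set.mem_preimage]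
    constructor
    · rintro ⟨hx, hB⟩
      rw [← D.T_eq hj hx]
      exact ⟨D.T_mem_level hj hx, hB⟩
    · rintro ⟨hx, hB⟩
      have hx' : x ∈ D.level n j := by
        obtain ⟨h1, h2⟩ := hx
        constructor <;> linarith
      rw [D.T_eq hj hx']
      exact ⟨hx', hB⟩
  rw [e, measure_preimage_add_right]

/-- The levels `a, …, a + b - 1` of column `n`. -/
def band (n a b : ℕ) : Set ℝ := ⋃ j ∈ Finset.range b, D.level n (a + j)

theorem volume_band_inter {n a b : ℕ} (h : a + b ≤ D.height n) {B : Set ℝ}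
    (hB : MeasurableSet B) :
    volume (D.band n a b ∩ B) = ∑ j ∈ Finset.range b, volume (D.level n (a + j) ∩ B) := by
  rw [band, Set.iUnion₂_inter, measure_biUnion_finset]
  · intro j hj j' hj' hne
    have h1 := Finset.mem_range.1 hj
    have h2 := Finset.mem_range.1 hj'
    exact (D.disjoint_levels n _ _ (by omega) (by omega) (by omega)).mono
      Set.inter_subset_left Set.inter_subset_left
  · exact fun j _ => (D.measurableSet_level _ _).inter hB

theorem band_mono_lower : Monotone fun n => D.band n 0 (D.height n - 1) := by
  refine monotone_nat_of_le_succ fun n x hx => ?_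
  simp only [band, Set.mem_iUnion, Finset.mem_range, exists_prop, zero_add] at hx ⊢
  obtain ⟨j, hj, hx⟩ := hx
  obtain ⟨i, hi, hxi⟩ := D.exists_copy (by omega) hx
  have := D.base_add_lt hi (j := j + 1) (by omega)
  exact ⟨_, by omega, hxi⟩

theorem band_mono_upper : Monotone fun n => D.band n 1 (D.height n - 1) := by
  refine monotone_nat_of_le_succ fun n x hx => ?_
  simp only [band, Set.mem_iUnion, Finset.mem_range, exists_prop] at hx ⊢
  obtain ⟨j, hj, hx⟩ := hx
  obtain ⟨i, hi, hxi⟩ := D.exists_copy (by omega) hx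
  have := D.base_add_lt hi (j := 1 + j) (by omega)
  refine ⟨D.base n i + j, by omega, ?_⟩
  rwa [show 1 + (D.base n i + j) = D.base n i + (1 + j) by omega]

theorem iUnion_band_lower : ⋃ n, D.band n 0 (D.height n - 1) = D.space := by
  ext x
  simp only [band, Set.mem_iUnion, Finset.mem_range, exists_prop, zero_add]
  constructor
  · rintro ⟨n, j, hj, hx⟩
    exact D.level_subset_space (by omega) hx
  · intro hx
    obtain ⟨n, j, hj, hxj⟩ := (D.eventually_mem_level hx).exists
    exact ⟨n, j, by omega, hxj⟩

theorem iUnion_band_upper (hL : 0 < L) :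
    (⋃ n, D.band n 1 (D.height n - 1) : Set ℝ) =ᵐ[volume] D.space := by
  have hsub : ⋃ n, D.band n 1 (D.height n - 1) ⊆ D.space := by
    intro x
    simp only [band, Set.mem_iUnion, Finset.mem_range, exists_prop]
    rintro ⟨n, j, hj, hx⟩
    exact D.level_subset_space (by omega) hx
  -- A point of the space in no upper band stays in the bottom level of all late columns, and the
  -- widths of these tend to zero.
  have hnull : volume (⋃ N, ⋂ n ≥ N, D.level n 0) = 0 := by
    refine measure_iUnion_null fun N => ?_
    have hlim : Filter.Tendsto (fun n => ENNReal.ofReal (D.width n)) Filter.atTop (nhds 0) := by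
      have := ENNReal.tendsto_ofReal (D.tendsto_width hL)
      rwa [ENNReal.ofReal_zero] at this
    refine le_antisymm (ge_of_tendsto hlim ?_) zero_le
    filter_upwards [Filter.eventually_ge_atTop N] with n hn
    rw [← D.volume_level n 0]
    exact measure_mono (Set.iInter₂_subset n hn)
  refine Filter.EventuallyLE.antisymm hsub.eventuallyLE ?_
  rw [ae_le_set]
  refine measure_mono_null (fun x hx => ?_) hnull
  obtain ⟨N, hN⟩ := Filter.eventually_atTop.1 (D.eventually_mem_level hx.1)
  refine Set.mem_iUnion.2 ⟨N, Set.mem_iInter₂.2 fun n hn => ?_⟩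
  obtain ⟨j, hj, hxj⟩ := hN n hn
  rcases j with _ | j
  · exact hxj
  · refine absurd (Set.mem_iUnion.2 ⟨n, ?_⟩) hx.2
    simp only [band, Set.mem_iUnion, Finset.mem_range, exists_prop]
    exact ⟨j, by omega, by rwa [add_comm 1 j]⟩

/-- In each column `T` translates the levels below the top onto those above the bottom; both
families increase to the whole space up to a null set. -/
theorem measurePreserving_T (hL : 0 < L) : MeasurePreserving D.T D.μ D.μ := by
  refine ⟨D.measurable_T, Measure.ext fun B hB => ?_⟩
  have hTB := D.measurable_T hB
  rw [Measure.map_apply D.measurable_T hB, μ, Measure.restrict_apply hTB, Measure.restrict_apply hB,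
    measure_congr ((ae_eq_refl B).inter (D.iUnion_band_upper hL)).symm, ← D.iUnion_band_lower,
    Set.inter_comm, Set.iUnion_inter, Set.inter_comm B, Set.iUnion_inter, Monotone.measure_iUnion,
    Monotone.measure_iUnion]
  · refine iSup_congr fun n => ?_
    have := D.height_pos n
    rw [D.volume_band_inter (by omega) hTB, D.volume_band_inter (by omega) hB]
    refine Finset.sum_congr rfl fun j hj => ?_
    have := Finset.mem_range.1 hj
    rw [zero_add, add_comm 1 j]
    exact D.volume_level_inter_preimage (by omega) B
  · exact fun n m h => Set.inter_subset_inter_left _ (D.band_mono_upper h)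
  · exact fun n m h => Set.inter_subset_inter_left _ (D.band_mono_lower h)

theorem measurePreserving_prodT (hL : 0 < L) :
    MeasurePreserving (D.prodT k) (D.prodMeasure k) (D.prodMeasure k) := by
  have : SigmaFinite D.μ := by unfold μ; infer_instance
  exact measurePreserving_pi _ _ fun _ => D.measurePreserving_T hL

/-! ### Mass of an invariant set in boxes -/

/-- The volume of the part of `A` in a box. -/
noncomputable def mass (A : Set (Fin k → ℝ)) (n : ℕ) (p : Fin k → ℕ) : ℝ :=
  volume.real (D.box n p ∩ A)

theorem volume_box_ne_top (n : ℕ) (p : Fin k → ℕ) : volume (D.box n p) ≠ ⊤ := by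
  rw [volume_box]
  exact ENNReal.ofReal_ne_top

theorem volume_real_box (n : ℕ) (p : Fin k → ℕ) : volume.real (D.box n p) = D.width n ^ k := by
  rw [measureReal_def, volume_box, ENNReal.toReal_ofReal (pow_nonneg (D.width_pos n).le k)]

theorem mass_nonneg (A : Set (Fin k → ℝ)) (n : ℕ) (p : Fin k → ℕ) : 0 ≤ D.mass A n p :=
  measureReal_nonneg

theorem mass_le (A : Set (Fin k → ℝ)) (n : ℕ) (p : Fin k → ℕ) : D.mass A n p ≤ D.width n ^ k := by
  rw [← D.volume_real_box n p]
  exact measureReal_mono Set.inter_subset_left (D.volume_box_ne_top n p)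

theorem mass_add_mass_compl {A : Set (Fin k → ℝ)} (hA : MeasurableSet A) (n : ℕ)
    (p : Fin k → ℕ) : D.mass A n p + D.mass Aᶜ n p = D.width n ^ k := by
  rw [← D.volume_real_box n p, mass, mass, ← Set.sdiff_eq]
  exact measureReal_inter_add_sdiff hA (D.volume_box_ne_top n p)

theorem mass_eq_sum (A : Set (Fin k → ℝ)) {n : ℕ} {p : Fin k → ℕ} (hp : ∀ j, p j < D.height n) :
    D.mass A n p =
      ∑ i : Fin k → Fin (D.r n), D.mass A (n + 1) fun j => D.base n (i j) + p j := by
  have h := D.measure_box_eq_sum (volume.restrict A) hp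
  simp only [Measure.restrict_apply (D.measurableSet_box _ _)] at h
  simp only [mass, measureReal_def]
  rw [h, ENNReal.toReal_sum]
  exact fun i _ => measure_ne_top_of_subset Set.inter_subset_left (D.volume_box_ne_top _ _)

theorem mass_succ {A : Set (Fin k → ℝ)} (hA : D.prodT k ⁻¹' A = A) {n : ℕ} {p : Fin k → ℕ}
    (hp : ∀ j, p j + 1 < D.height n) : D.mass A n (fun j => p j + 1) = D.mass A n p := by
  have e : D.box n p ∩ A = (fun x => x + fun j => D.left n (p j + 1) - D.left n (p j)) ⁻¹'
      (D.box n (fun j => p j + 1) ∩ A) := by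
    have key : ∀ x ∈ D.box n p,
        D.prodT k x = x + fun j => D.left n (p j + 1) - D.left n (p j) :=
      fun x hx => funext fun j => D.T_eq (hp j) (D.mem_box.1 hx j)
    ext x
    simp only [Set.mem_inter_iff, Set.mem_preimage]
    constructor
    · rintro ⟨hx, hB⟩
      rw [← key x hx]
      exact ⟨D.prodT_mem_box hp hx, by rwa [← hA] at hB⟩
    · rintro ⟨hx, hB⟩
      have hx' : x ∈ D.box n p := D.mem_box.2 fun j => by
        obtain ⟨h1, h2⟩ := D.mem_box.1 hx j
        simp only [Pi.add_apply] at h1 h2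
        constructor <;> linarith
      rw [← key x hx'] at hB
      exact ⟨hx', by rwa [← hA]⟩
  rw [mass, mass, e, measureReal_def, measureReal_def, measure_preimage_add_right]

theorem mass_add {A : Set (Fin k → ℝ)} (hA : D.prodT k ⁻¹' A = A) {n : ℕ} {p : Fin k → ℕ}
    (t : ℕ) (hp : ∀ j, p j + t < D.height n) :
    D.mass A n (fun j => p j + t) = D.mass A n p := by
  induction t with
  | zero => rfl
  | succ t ih =>
    rw [← ih fun j => by have := hp j; omega]
    exact D.mass_succ hA (p := fun j => p j + t) hp

theorem base_last_succ (n : ℕ) (d : Fin L) :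
    D.base n (D.r n - L - 1 + d + 1) =
      D.base n (D.r n - L - 1 + d) + 2 * D.height n + (D.s n).1 d := by
  have hr := D.lt_r n
  have hd := d.2
  have e : D.r n - L - 1 + d + L + 1 - D.r n = d := by omega
  rw [base_succ, spacerCount, if_neg (by omega), dif_pos (by omega)]
  have e2 : (⟨D.r n - L - 1 + d + L + 1 - D.r n, by omega⟩ : Fin L) = d := Fin.ext e
  rw [e2]
  omega

/-- Masses agree for copies in consecutive positions among the last ones, if the spacers
compensate for the difference of the levels. -/
theorem mass_copy_eq_mass_copy_succ {A : Set (Fin k → ℝ)} (hA : D.prodT k ⁻¹' A = A) {n : ℕ}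
    {p q a b : Fin k → ℕ} {c : ℕ} (hq : ∀ j, q j < D.height n)
    (hpq : ∀ j, p j + b j = q j + a j) (d : Fin k → Fin L)
    (hd : ∀ j, (D.s n).1 (d j) + b j = a j + c) :
    D.mass A (n + 1) (fun j => D.base n (D.r n - L - 1 + d j) + p j) =
      D.mass A (n + 1) fun j => D.base n (D.r n - L - 1 + d j + 1) + q j := by
  have e : ∀ j, D.base n (D.r n - L - 1 + d j + 1) + q j =
      D.base n (D.r n - L - 1 + d j) + p j + (2 * D.height n + c) := by
    intro j
    have := hpq j
    have := hd j
    rw [base_last_succ]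
    omega
  simp only [e]
  refine (D.mass_add hA _ fun j => ?_).symm
  rw [← e]
  have hr := D.lt_r n
  have := (d j).2
  exact D.base_add_lt (by omega) (hq j)

/-- The matched terms cancel. What remains of these two indices is `f i₁ - g i₀`, a difference of
two numbers in `[0, w]`, which costs only `w`. -/
theorem abs_sum_sub_sum_le_of_match {ι : Type*} [Fintype ι] [DecidableEq ι] {f g : ι → ℝ}
    {i₀ i₁ : ι} (hne : i₀ ≠ i₁) (h : f i₀ = g i₁) {w ε : ℝ} (hf0 : ∀ i, 0 ≤ f i)
    (hf : ∀ i, f i ≤ w) (hg0 : ∀ i, 0 ≤ g i) (hg : ∀ i, g i ≤ w) (hε : ∀ i, |f i - g i| ≤ ε) :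
    |∑ i, f i - ∑ i, g i| ≤ w + (Fintype.card ι - 2) * ε := by
  have hs : ∀ F : ι → ℝ,
      ∑ i, F i = F i₀ + (F i₁ + ∑ i ∈ (Finset.univ.erase i₀).erase i₁, F i) := by
    intro F
    rw [Finset.add_sum_erase _ _ (by simp [hne.symm]), Finset.add_sum_erase _ _ (by simp)]
  have hc : ((((Finset.univ : Finset ι).erase i₀).erase i₁).card : ℝ) = Fintype.card ι - 2 := by
    have h2 : 2 ≤ Fintype.card ι := by
      rw [← Finset.card_univ, ← Finset.card_pair hne]
      exact Finset.card_le_card (Finset.subset_univ _)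
    rw [Finset.card_erase_of_mem (by simp [hne.symm]), Finset.card_erase_of_mem (by simp),
      Finset.card_univ, Nat.sub_sub, Nat.cast_sub h2]
    norm_num
  have hr : |∑ i ∈ (Finset.univ.erase i₀).erase i₁, (f i - g i)| ≤
      (Fintype.card ι - 2) * ε := by
    refine (Finset.abs_sum_le_sum_abs _ _).trans ?_
    rw [← hc, ← nsmul_eq_mul]
    exact Finset.sum_le_card_nsmul _ _ _ fun i _ => hε i
  rw [hs f, hs g]
  rw [Finset.sum_sub_distrib] at hr
  rw [abs_le] at hr ⊢
  have := hf0 i₁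
  have := hf i₁
  have := hg0 i₀
  have := hg i₀
  constructor <;> linarith [hr.1, hr.2]

/-- With `R = r ^ k` copies, a stage using `u` bounds the relative discrepancy by `1 / R + (1 - 2 /
R) * E`, where `E` bounds it in the next column. The fixed point of this map is `1/2`, and the
distance to it shrinks by the factor `1 - 2 / R`. Other stages only average. -/
theorem abs_mass_sub_mass_le_prod {A : Set (Fin k → ℝ)} (hA : D.prodT k ⁻¹' A = A) (hk : 0 < k)
    {a b : Fin k → ℕ} {c : ℕ} (u : SpacerVector L) (d : Fin k → Fin L)
    (hd : ∀ j, u.1 (d j) + b j = a j + c) {x : ℕ → ℝ}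
    (hx : ∀ n, D.s n = u → x n = 2 / (D.r n : ℝ) ^ k) (hx' : ∀ n, D.s n ≠ u → x n = 0) (l : ℕ) :
    ∀ (n : ℕ) (p q : Fin k → ℕ), (∀ j, p j < D.height n) → (∀ j, q j < D.height n) →
      (∀ j, p j + b j = q j + a j) →
      |D.mass A n p - D.mass A n q| ≤
        D.width n ^ k * (1 / 2 + 1 / 2 * ∏ i ∈ Finset.range l, (1 - x (n + i))) := by
  induction l with
  | zero =>
    intro n p q _ _ _
    have h1 := D.mass_nonneg A n p
    have h2 := D.mass_nonneg A n q
    have h3 := D.mass_le A n p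
    have h4 := D.mass_le A n q
    rw [Finset.prod_range_zero, abs_le]
    constructor <;> linarith
  | succ l ih =>
    intro n p q hp hq hpq
    have hR : (0 : ℝ) < (D.r n : ℝ) ^ k := by
      have : (0 : ℝ) < D.r n := by exact_mod_cast D.r_pos n
      positivity
    have e1 : ∀ i, x (n + (i + 1)) = x (n + 1 + i) := fun i => by
      rw [show n + (i + 1) = n + 1 + i by omega]
    rw [Finset.prod_range_succ', D.width_pow_eq n, D.mass_eq_sum A hp, D.mass_eq_sum A hq]
    simp only [e1, add_zero]
    have hi := fun i : Fin k → Fin (D.r n) =>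
      ih (n + 1) _ _ (D.copy_lt hp i) (D.copy_lt hq i) fun j => by
        have := hpq j
        omega
    generalize ∏ i ∈ Finset.range l, (1 - x (n + 1 + i)) = Q at hi ⊢
    have hcard : (Fintype.card (Fin k → Fin (D.r n)) : ℝ) = (D.r n : ℝ) ^ k := by simp
    by_cases hs : D.s n = u
    · have hr := D.lt_r n
      let i₀ : Fin k → Fin (D.r n) := fun j => ⟨D.r n - L - 1 + d j, by omega⟩
      let i₁ : Fin k → Fin (D.r n) := fun j => ⟨D.r n - L - 1 + d j + 1, by omega⟩
      have hne : i₀ ≠ i₁ := by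
        intro h
        have := congrArg Fin.val (congrFun h ⟨0, hk⟩)
        simp only [i₀, i₁] at this
        omega
      refine (abs_sum_sub_sum_le_of_match hne ?_ (fun i => D.mass_nonneg _ _ _)
        (fun i => D.mass_le _ _ _) (fun i => D.mass_nonneg _ _ _) (fun i => D.mass_le _ _ _)
        hi).trans_eq ?_
      · exact D.mass_copy_eq_mass_copy_succ hA hq hpq d (c := c) (by rw [hs]; exact hd)
      · rw [hcard, hx n hs]
        field_simp
        ring
    · rw [hx' n hs, ← Finset.sum_sub_distrib]
      refine (Finset.abs_sum_le_sum_abs _ _).trans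
        ((Finset.sum_le_card_nsmul _ _ _ fun i _ => hi i).trans_eq ?_)
      rw [nsmul_eq_mul, Finset.card_univ, hcard]
      ring

theorem tendsto_prod_one_sub_of_not_summable {x : ℕ → ℝ} (h0 : ∀ n, 0 ≤ x n)
    (h1 : ∀ n, x n ≤ 1) (hx : ¬ Summable x) :
    Filter.Tendsto (fun l => ∏ i ∈ Finset.range l, (1 - x i)) Filter.atTop (nhds 0) := by
  have ht := (not_summable_iff_tendsto_nat_atTop_of_nonneg h0).1 hx
  refine squeeze_zero (fun l => Finset.prod_nonneg fun i _ => by linarith [h1 i])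
    (fun l => ?_) (Real.tendsto_exp_neg_atTop_nhds_zero.comp ht)
  simp only [Function.comp_apply, ← Finset.sum_neg_distrib, Real.exp_sum]
  exact Finset.prod_le_prod (fun i _ => by linarith [h1 i])
    fun i _ => Real.one_sub_le_exp_neg _

theorem not_summable_of_tsum_eq_top
    (h : ∑' i : ℕ, ((1 : ENNReal) / (D.r i : ENNReal)) ^ k = ⊤) :
    ¬ Summable fun n => 2 / (D.r n : ℝ) ^ k := by
  intro hs
  refine (hs.div_const 2).tsum_ofReal_ne_top ?_
  rw [← h]
  refine tsum_congr fun n => ?_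
  have hr : (0 : ℝ) < D.r n := by exact_mod_cast D.r_pos n
  have e : (2 / (D.r n : ℝ) ^ k) / 2 = (1 / (D.r n : ℝ)) ^ k := by
    rw [one_div_pow]
    ring
  rw [e, ENNReal.ofReal_pow (by positivity), ENNReal.ofReal_div_of_pos hr, ENNReal.ofReal_one,
    ENNReal.ofReal_natCast]

/-- The stages using `u` contain a full residue class, and for an antitone sequence summability
along one class forces summability. -/
theorem not_summable_stages (h : ¬ Summable fun n => 2 / (D.r n : ℝ) ^ k) (u : SpacerVector L) :
    ¬ Summable ({n | D.s n = u}.indicator fun n => 2 / (D.r n : ℝ) ^ k) := by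
  obtain ⟨v, rfl⟩ := D.v_surjective u
  have : NeZero (2 ^ (v + 1)) := ⟨by positivity⟩
  have hanti : Antitone fun n => 2 / (D.r n : ℝ) ^ k := by
    intro n m hnm
    have hr : (0 : ℝ) < D.r n := by exact_mod_cast D.r_pos n
    have hm : (D.r n : ℝ) ≤ D.r m := by exact_mod_cast D.r_mono hnm
    have := pow_le_pow_left₀ hr.le hm k
    exact div_le_div_of_nonneg_left zero_le_two (by positivity) this
  -- The residue is `2 ^ v - 1` because stages are numbered from `0`.
  rw [← summable_indicator_mod_iff hanti (((2 ^ v - 1 : ℕ) : ZMod (2 ^ (v + 1))))] at h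
  refine fun hs => h (hs.of_norm_bounded_eventually_nat ?_)
  refine Filter.Eventually.of_forall fun n => ?_
  have h0 : ∀ n, 0 ≤ 2 / (D.r n : ℝ) ^ k := fun n => by positivity
  rw [Real.norm_of_nonneg (Set.indicator_nonneg (fun n _ => h0 n) _)]
  refine Set.indicator_le_indicator_of_subset (fun n hn => ?_) h0 n
  have hn' : n % 2 ^ (v + 1) = (2 ^ v - 1) % 2 ^ (v + 1) :=
    (ZMod.natCast_eq_natCast_iff' _ _ _).1 hn
  have hp : 0 < 2 ^ v := by positivity
  have hlt : 2 ^ v - 1 < 2 ^ (v + 1) := by rw [pow_succ]; omega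
  rw [Nat.mod_eq_of_lt hlt] at hn'
  refine D.s_eq n v (n / 2 ^ (v + 1)) ?_
  have := Nat.mod_add_div' n (2 ^ (v + 1))
  omega

theorem abs_mass_sub_mass_le {A : Set (Fin k → ℝ)} (hA : D.prodT k ⁻¹' A = A) (hk : 0 < k)
    (hL : 0 < L) (h : ¬ Summable fun n => 2 / (D.r n : ℝ) ^ k) {n : ℕ} {a b : Fin k → ℕ} {c : ℕ}
    (u : SpacerVector L) (d : Fin k → Fin L) (hd : ∀ j, u.1 (d j) + b j = a j + c)
    (ha : ∀ j, a j < D.height n) (hb : ∀ j, b j < D.height n) :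
    |D.mass A n a - D.mass A n b| ≤ D.width n ^ k / 2 := by
  set x := {n | D.s n = u}.indicator fun n => 2 / (D.r n : ℝ) ^ k with hx
  have h0 : ∀ n, 0 ≤ x n := Set.indicator_nonneg fun n _ => by positivity
  have h1 : ∀ n, x n ≤ 1 := by
    refine fun n => Set.indicator_apply_le' (fun _ => ?_) fun _ => zero_le_one
    have hr : (2 : ℝ) ≤ D.r n := by exact_mod_cast (by have := D.lt_r n; omega : 2 ≤ D.r n)
    have := le_self_pow₀ (by linarith : (1 : ℝ) ≤ D.r n) hk.ne'
    exact div_le_one_of_le₀ (by linarith) (by positivity)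
  have hns : ¬ Summable fun i => x (n + i) := by
    simp only [add_comm n]
    rw [summable_nat_add_iff]
    exact D.not_summable_stages h u
  have hlim := ((tendsto_prod_one_sub_of_not_summable (fun i => h0 (n + i))
    (fun i => h1 (n + i)) hns).const_mul (1 / 2)).const_add (1 / 2) |>.const_mul (D.width n ^ k)
  refine (ge_of_tendsto' hlim fun l => D.abs_mass_sub_mass_le_prod hA hk u d hd
    (fun m hm => Set.indicator_of_mem (s := {n | D.s n = u}) hm _)
    (fun m hm => Set.indicator_of_notMem (s := {n | D.s n = u}) hm _)
    l n a b ha hb fun j => add_comm _ _).trans_eq ?_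
  ring

/-- The required entries `a j + h - b j` are positive and take at most `k ≤ L` values; enlarge them
to a set of `L` positive integers and sort it. The set is built one lower and shifted up to ensure
positivity. -/
theorem exists_spacerVector (hkL : k ≤ L) {h : ℕ} {a b : Fin k → ℕ} (hb : ∀ j, b j < h) :
    ∃ (u : SpacerVector L) (d : Fin k → Fin L), ∀ j, u.1 (d j) + b j = a j + h := by
  obtain ⟨s, hs, hcard⟩ := Infinite.exists_superset_card_eq
    (Finset.univ.image fun j => a j + (h - 1 - b j)) L
    (Finset.card_image_le.trans (by simpa using hkL))
  have hmem : ∀ j, ∃ d, s.orderEmbOfFin hcard d = a j + (h - 1 - b j) := fun j => by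
    have : a j + (h - 1 - b j) ∈ Set.range (s.orderEmbOfFin hcard) := by
      rw [Finset.range_orderEmbOfFin]
      exact hs (Finset.mem_image_of_mem _ (Finset.mem_univ j))
    exact this
  choose d hd using hmem
  refine ⟨⟨fun i => s.orderEmbOfFin hcard i + 1, fun i => Nat.succ_pos _, fun i i' hii' => ?_⟩,
    d, fun j => ?_⟩
  · exact Nat.succ_lt_succ ((s.orderEmbOfFin hcard).strictMono hii')
  · have := hb j
    simp only [hd]
    omega

/-! ### Lebesgue density and ergodicity -/

theorem box_ae_eq_closedBall (n : ℕ) (p : Fin k → ℕ) :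
    D.box n p =ᵐ[volume]
      Metric.closedBall (fun j => D.left n (p j) + D.width n / 2) (D.width n / 2) := by
  rw [closedBall_pi _ (by linarith [D.width_pos n])]
  simp only [Real.closedBall_eq_Icc, add_sub_cancel_right, add_assoc, add_halves]
  rw [Set.pi_univ_Icc]
  exact Measure.univ_pi_Ico_ae_eq_Icc

/-- Boxes are sup-norm balls up to null sets, but are not centred at the density point; hence the
density theorem for balls that merely contain the point. Having this for all large `n` lets two sets
share a column. -/
theorem eventually_exists_dense_box (hL : 0 < L) {S : Set (Fin k → ℝ)} (hS : MeasurableSet S)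
    (hpos : volume (S ∩ Set.univ.pi fun _ => D.space) ≠ 0) :
    ∀ᶠ n in Filter.atTop, ∃ p : Fin k → ℕ, (∀ j, p j < D.height n) ∧
      3 / 4 * D.width n ^ k < D.mass S n p := by
  have hX : MeasurableSet (Set.univ.pi fun _ : Fin k => D.space) :=
    .univ_pi fun _ => D.measurableSet_space
  have hae := ae_restrict_of_ae_restrict_of_subset
    (Set.inter_subset_left (s := S) (t := Set.univ.pi fun _ => D.space))
    (IsUnifLocDoublingMeasure.ae_tendsto_measure_inter_div volume S 1)
  have : (ae (volume.restrict (S ∩ Set.univ.pi fun _ => D.space))).NeBot := by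
    rw [ae_neBot]
    exact fun h => hpos (Measure.restrict_eq_zero.1 h)
  obtain ⟨x, hx, hxS⟩ := (hae.and (ae_restrict_mem (hS.inter hX))).exists
  have hev := D.eventually_mem_box fun j => hxS.2 j (Set.mem_univ j)
  obtain ⟨p, hp⟩ := hev.choice
  have hδ : Filter.Tendsto (fun n => D.width n / 2) Filter.atTop (nhdsWithin 0 (Set.Ioi 0)) := by
    refine tendsto_nhdsWithin_iff.2 ⟨?_, Filter.Eventually.of_forall fun n => ?_⟩
    · have := (D.tendsto_width hL).div_const 2
      rwa [zero_div] at this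
    · exact half_pos (D.width_pos n)
  have hlim := hx (fun n j => D.left n (p n j) + D.width n / 2) _ hδ (by
    filter_upwards [hp] with n hn
    rw [one_mul, closedBall_pi _ (by linarith [D.width_pos n])]
    intro j _
    obtain ⟨h1, h2⟩ := D.mem_box.1 hn.2 j
    simp only [Real.closedBall_eq_Icc]
    constructor <;> linarith)
  have h34 : ENNReal.ofReal (3 / 4) < 1 := by
    rw [← ENNReal.ofReal_one]
    exact (ENNReal.ofReal_lt_ofReal_iff one_pos).2 (by norm_num)
  filter_upwards [hp, hlim.eventually_const_lt h34] with n hn hlt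
  refine ⟨p n, fun j => by have := hn.1 j; omega, ?_⟩
  have hw : 0 < D.width n ^ k := pow_pos (D.width_pos n) k
  rw [← measure_congr (D.box_ae_eq_closedBall n (p n)),
    ← measure_congr ((ae_eq_refl S).inter (D.box_ae_eq_closedBall n (p n))), Set.inter_comm,
    volume_box, ENNReal.lt_div_iff_mul_lt (by simp [hw]) (by simp),
    ← ENNReal.ofReal_mul (by norm_num)] at hlt
  rw [mass, measureReal_def]
  refine (ENNReal.ofReal_lt_iff_lt_toReal (by positivity) ?_).1 hlt
  exact measure_ne_top_of_subset Set.inter_subset_left (D.volume_box_ne_top _ _)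

theorem ergodic_prodT (hk : 0 < k) (hkL : k ≤ L)
    (h : ∑' i : ℕ, ((1 : ENNReal) / (D.r i : ENNReal)) ^ k = ⊤) :
    Ergodic (D.prodT k) (D.prodMeasure k) := by
  have hL : 0 < L := hk.trans_le hkL
  refine { D.measurePreserving_prodT hL with aeconst_set := fun A hA hTA => ?_ }
  by_contra hcon
  rw [Filter.eventuallyConst_set', not_or, ae_eq_empty, ae_eq_univ, prodMeasure_eq,
    Measure.restrict_apply hA, Measure.restrict_apply hA.compl] at hcon
  obtain ⟨n, ⟨a, ha, hA1⟩, b, hb, hA2⟩ := ((D.eventually_exists_dense_box hL hA hcon.1).and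
    (D.eventually_exists_dense_box hL hA.compl hcon.2)).exists
  obtain ⟨u, d, hd⟩ := exists_spacerVector hkL (a := a) hb
  have hle := D.abs_mass_sub_mass_le hTA hk hL (D.not_summable_of_tsum_eq_top h) u d hd ha hb
  -- `A` fills more than `3/4` of box `a` and less than `1/4` of box `b`, against `hle`.
  have hsum := D.mass_add_mass_compl hA n b
  have := (abs_le.1 hle).2
  linarith

/-! ### Rigidity of the positions of copies -/

/-- The distance between the bottoms of consecutive copies of column `n`, other than the last
ones. -/
def step (n : ℕ) : ℕ := (2 * L + 2) * D.height n + ∑ d, (D.s n).1 d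

theorem base_eq_mul_step {n i : ℕ} (hi : i + L + 1 ≤ D.r n) : D.base n i = i * D.step n := by
  induction i with
  | zero => simp [Params.base, copyBase]
  | succ i ih =>
    rw [base_succ, ih (by omega), spacerCount, if_pos (by omega), step]
    ring

theorem base_add_two_mul_le {n i i' : ℕ} (h : i < i') (hi' : i' < D.r n) :
    D.base n i + 2 * D.height n ≤ D.base n i' := by
  have h1 : D.base n (i + 1) ≤ D.base n i' := (D.base_strictMono n).monotone h
  refine le_trans ?_ h1
  by_cases hi : i + L + 1 < D.r n
  · rw [D.base_eq_mul_step hi.le, D.base_eq_mul_step (i := i + 1) (by omega), step]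
    ring_nf
    omega
  · have := D.base_last_succ n ⟨i + L + 1 - D.r n, by omega⟩
    have hr := D.lt_r n
    simp only [show D.r n - L - 1 + (i + L + 1 - D.r n) = i by omega] at this
    omega

/-- The last `L` gaps `2 * h + u_d` add up to `2 * L * h + σ`, which is `step - 2 * h`: all the last
copies start within less than one step. -/
theorem base_last (n : ℕ) :
    D.base n (D.r n - 1) + 2 * D.height n = D.base n (D.r n - L - 1) + D.step n := by
  obtain ⟨m, hm⟩ : ∃ m, D.r n = m + (L + 1) := ⟨D.r n - (L + 1), by have := D.lt_r n; omega⟩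
  have h1 := stackHeight_eq (D.r n) (D.height n) (D.s n) (D.lt_r n)
  have h2 := D.base_succ n (D.r n - 1)
  rw [Nat.sub_add_cancel (D.r_pos n), spacerCount, if_neg (by omega), dif_neg (by omega)] at h2
  change D.base n (D.r n) = _ at h1
  rw [D.base_eq_mul_step (i := D.r n - L - 1) (by omega)]
  have e1 : D.r n - L - 1 = m := by omega
  have h3 : D.r n * D.height n = (m + (L + 1)) * D.height n := by rw [hm]
  rw [e1] at h1 ⊢
  rw [step]
  linarith

theorem base_le_of_ge {n i : ℕ} (hi : i < D.r n) :
    D.base n i + 2 * D.height n ≤ D.base n (D.r n - L - 1) + D.step n := by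
  rw [← base_last]
  have := (D.base_strictMono n).monotone (Nat.le_sub_one_of_lt hi)
  omega

/-- If a copy that is not among the last ones is moved up and another copy is moved by almost the
same amount, then both are moved by exactly the same amount. -/
theorem base_add_base_eq {n i i' l l' : ℕ} (hi : i + L + 1 < D.r n) (hii' : i < i')
    (hi' : i' < D.r n) (hl' : l' < D.r n)
    (h1 : D.base n i' + D.base n l < D.base n i + D.base n l' + D.height n)
    (h2 : D.base n i + D.base n l' < D.base n i' + D.base n l + D.height n) :
    D.base n i' + D.base n l = D.base n i + D.base n l' := by
  obtain ⟨m, hm⟩ : ∃ m, m = D.r n - L - 1 := ⟨_, rfl⟩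
  have mono := (D.base_strictMono n).monotone
  have hstep : 2 * D.height n ≤ D.step n := by
    rw [step]
    ring_nf
    omega
  have top : ∀ {x}, x < D.r n → D.base n x + 2 * D.height n ≤ D.base n m + D.step n :=
    fun hx => by rw [hm]; exact D.base_le_of_ge hx
  have up : D.base n i + D.step n ≤ D.base n i' := by
    refine le_trans (le_of_eq ?_) (mono hii')
    rw [D.base_eq_mul_step hi.le, D.base_eq_mul_step (i := i + 1) (by omega)]
    ring
  -- The move from `l` to `l'` exceeds `step - h`, whereas a move starting among the last copies is
  -- at most `step - 2 * h`.
  have hlm : l < m := by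
    by_contra hlm
    have := mono (not_lt.1 hlm)
    have := top hl'
    omega
  -- Division by `step`: the remainder is zero up to index `m` and at least `2 * h` beyond it.
  have key : ∀ x, x < D.r n → ∃ a ρ, a ≤ m ∧ D.base n x = a * D.step n + ρ ∧
      ρ + 2 * D.height n ≤ D.step n ∧ (x ≤ m ∧ ρ = 0 ∨ m < x ∧ a = m ∧ 2 * D.height n ≤ ρ) := by
    intro x hx
    rcases le_or_gt x m with hxm | hxm
    · exact ⟨x, 0, hxm, by rw [D.base_eq_mul_step (by omega)]; rfl, by omega, .inl ⟨hxm, rfl⟩⟩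
    · have g := D.base_add_two_mul_le hxm hx
      have t := top hx
      have e := D.base_eq_mul_step (n := n) (i := m) (by omega)
      exact ⟨m, D.base n x - D.base n m, le_rfl, by omega, by omega, .inr ⟨hxm, rfl, by omega⟩⟩
  obtain ⟨a, ρ, ha, ea, hρ, ca⟩ := key i' hi'
  obtain ⟨b, τ, hb, eb, hτ, cb⟩ := key l' hl'
  have ei := D.base_eq_mul_step (n := n) (i := i) hi.le
  have el := D.base_eq_mul_step (n := n) (i := l) (by omega)
  -- Remainders are at most `step - 2 * h` and the error is below `h`, so the quotients must
  -- balance.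
  have hab : a + l = i + b := by
    rcases lt_trichotomy (a + l) (i + b) with h | h | h
    · have := Nat.mul_le_mul_right (D.step n) (Nat.succ_le_of_lt h)
      simp only [Nat.succ_eq_add_one, add_mul, one_mul] at this
      omega
    · exact h
    · have := Nat.mul_le_mul_right (D.step n) (Nat.succ_le_of_lt h)
      simp only [Nat.succ_eq_add_one, add_mul, one_mul] at this
      omega
  have hab' := congrArg (· * D.step n) hab
  simp only [add_mul] at hab'
  rcases ca with ⟨_, hρ0⟩ | ⟨hi'm, ham, hρh⟩ <;> rcases cb with ⟨_, hτ0⟩ | ⟨hl'm, hbm, hτh⟩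
  · omega
  · omega
  · omega
  · subst ham hbm
    have hil : i' = l' := by
      rcases lt_trichotomy i' l' with h | h | h
      · have := D.base_add_two_mul_le h hl'
        omega
      · exact h
      · have := D.base_add_two_mul_le h hi'
        omega
    subst hil
    omega

/-- If two choices of copies both involve a copy that is not among the last ones, and the
resulting levels differ by a constant, then so do the original levels. -/
theorem diff_const_of_copy_diff_const {n : ℕ} {i i' q q' : Fin k → ℕ} {c c' : ℕ}
    (hi : ∀ j, i j < D.r n) (hi' : ∀ j, i' j < D.r n) (hg : ∃ j, i j + L + 1 < D.r n)
    (hg' : ∃ j, i' j + L + 1 < D.r n) (hq : ∀ j, 2 * q j < D.height n)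
    (hq' : ∀ j, 2 * q' j < D.height n)
    (h : ∀ j, D.base n (i j) + q j + c = D.base n (i' j) + q' j + c') :
    ∃ e e', ∀ j, q j + e = q' j + e' := by
  -- Both levels lie in the lower half of the column, so each coordinate contributes an error below
  -- `h / 2`.
  have close : ∀ j l,
      D.base n (i' j) + D.base n (i l) < D.base n (i j) + D.base n (i' l) + D.height n := by
    intro j l
    have := hq j
    have := hq' j
    have := hq l
    have := hq' l
    have := h j
    have := h l
    omega
  suffices ∃ j, ∀ l,
      D.base n (i' j) + D.base n (i l) = D.base n (i j) + D.base n (i' l) by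
    obtain ⟨j, hj⟩ := this
    refine ⟨c + D.base n (i j), c' + D.base n (i' j), fun l => ?_⟩
    have := hj l
    have := h l
    omega
  obtain ⟨j, hj⟩ := hg
  refine ⟨j, ?_⟩
  rcases lt_trichotomy (i j) (i' j) with hlt | heq | hgt
  · exact fun l => D.base_add_base_eq hj hlt (hi' j) (hi' l) (close j l)
      (by have := close l j; omega)
  · intro l
    have h1 := close j l
    have h2 := close l j
    rcases lt_trichotomy (i l) (i' l) with hl | hl | hl
    · have := D.base_add_two_mul_le hl (hi' l)
      rw [heq] at h1 h2
      omega
    · rw [heq, hl]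
    · have := D.base_add_two_mul_le hl (hi l)
      rw [heq] at h1 h2
      omega
  -- Now the move at `j` goes down, so the roles of `i` and `i'` are exchanged, starting from a
  -- coordinate where `i'` is not among the last copies.
  · obtain ⟨j', hj'⟩ := hg'
    have hlt : i' j' < i j' := by
      have := D.base_add_two_mul_le hgt (hi j)
      have := close j' j
      exact (D.base_strictMono n).lt_iff_lt.1 (by omega)
    have key := fun l => D.base_add_base_eq (l := i' l) hj' hlt (hi j') (hi l)
      (by have := close l j'; omega) (by have := close j' l; omega)
    intro l
    have := key l
    have := key j
    omega

/-- The levels of column `n + l` that can be reached from the levels `a` of column `n` by choosing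
at each stage copies that are not all among the last ones. -/
def reach (n : ℕ) (a : Fin k → ℕ) : ℕ → Set (Fin k → ℕ)
  | 0 => {a}
  | l + 1 => {p | ∃ q ∈ reach n a l, ∃ i : Fin k → ℕ, (∀ j, i j < D.r (n + l)) ∧
      (∃ j, i j + L + 1 < D.r (n + l)) ∧ p = fun j => D.base (n + l) (i j) + q j}

theorem two_mul_lt_of_mem_reach {n l : ℕ} {a p : Fin k → ℕ} (ha : ∀ j, 2 * a j < D.height n)
    (hp : p ∈ D.reach n a l) (j : Fin k) : 2 * p j < D.height (n + l) := by
  induction l generalizing p with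
  | zero =>
    rw [reach, Set.mem_singleton_iff] at hp
    subst hp
    exact ha j
  | succ l ih =>
    obtain ⟨q, hq, i, hi, -, rfl⟩ := hp
    have := ih hq
    have := D.two_mul_base_add_le (hi j) (j := q j) (by omega)
    rw [← add_assoc n l 1]
    simp only
    omega

theorem diff_const_of_reach {n l : ℕ} {a b p q : Fin k → ℕ} (ha : ∀ j, 2 * a j < D.height n)
    (hb : ∀ j, 2 * b j < D.height n) (hp : p ∈ D.reach n a l) (hq : q ∈ D.reach n b l)
    (h : ∃ c c', ∀ j, p j + c = q j + c') : ∃ c c', ∀ j, a j + c = b j + c' := by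
  induction l generalizing p q with
  | zero =>
    rw [reach, Set.mem_singleton_iff] at hp hq
    subst hp hq
    exact h
  | succ l ih =>
    obtain ⟨p, hp, i, hi, hg, rfl⟩ := hp
    obtain ⟨q, hq, i', hi', hg', rfl⟩ := hq
    obtain ⟨c, c', h⟩ := h
    exact ih hp hq (D.diff_const_of_copy_diff_const hi hi' hg hg'
      (D.two_mul_lt_of_mem_reach ha hp) (D.two_mul_lt_of_mem_reach hb hq) h)

/-! ### Measure of the points that avoid the last copies -/

/-- The points all of whose coordinates are in one of the last copies of column `n`. -/
def allLast (k n : ℕ) : Set (Fin k → ℝ) :=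
  {x | ∃ p : Fin k → ℕ, (∀ j, p j < D.height n) ∧ ∃ d : Fin k → Fin (L + 1),
    x ∈ D.box (n + 1) fun j => D.base n (D.r n - L - 1 + d j) + p j}

theorem volume_box_inter_allLast_le_width {n : ℕ} {p : Fin k → ℕ} (hp : ∀ j, p j < D.height n) :
    volume (D.box n p ∩ D.allLast k n) ≤
      (L + 1 : ENNReal) ^ k * ENNReal.ofReal (D.width (n + 1) ^ k) := by
  have hr := D.lt_r n
  have hsub : D.box n p ∩ D.allLast k n ⊆ ⋃ d : Fin k → Fin (L + 1),
      D.box (n + 1) fun j => D.base n (D.r n - L - 1 + d j) + p j := by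
    rintro x ⟨hx, p', hp', d, hxd⟩
    have := D.box_subset_box hp' (fun j => ⟨D.r n - L - 1 + d j, by omega⟩) hxd
    obtain rfl := D.eq_of_mem_box hp hp' hx this
    exact Set.mem_iUnion.2 ⟨d, hxd⟩
  refine (measure_mono hsub).trans ((measure_iUnion_fintype_le _ _).trans_eq ?_)
  simp [volume_box]

theorem ofReal_width_pow_eq (n : ℕ) : ENNReal.ofReal (D.width n ^ k) =
    (D.r n : ENNReal) ^ k * ENNReal.ofReal (D.width (n + 1) ^ k) := by
  rw [width_pow_eq, ENNReal.ofReal_mul (by positivity), ENNReal.ofReal_pow (by positivity),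
    ENNReal.ofReal_natCast]

/-- The proportion bound at stage `n + l` holds in every box of that column and passes to earlier
boxes by averaging over equal copies. -/
theorem volume_box_inter_allLast_le (l : ℕ) {n : ℕ} {p : Fin k → ℕ}
    (hp : ∀ j, p j < D.height n) :
    volume (D.box n p ∩ D.allLast k (n + l)) ≤
      (L + 1 : ENNReal) ^ k * (1 / (D.r (n + l) : ENNReal)) ^ k *
        ENNReal.ofReal (D.width n ^ k) := by
  induction l generalizing n p with
  | zero =>
    refine (D.volume_box_inter_allLast_le_width hp).trans_eq ?_
    have hr : (D.r n : ENNReal) ≠ 0 := by exact_mod_cast (D.r_pos n).ne'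
    rw [D.ofReal_width_pow_eq n, add_zero, mul_assoc]
    congr 1
    rw [← mul_assoc, ← mul_pow, one_div,
      ENNReal.inv_mul_cancel hr (ENNReal.natCast_ne_top _), one_pow, one_mul]
  | succ l ih =>
    have h := D.measure_box_eq_sum (volume.restrict (D.allLast k (n + (l + 1)))) hp
    simp only [Measure.restrict_apply (D.measurableSet_box _ _)] at h
    rw [h, D.ofReal_width_pow_eq n]
    refine (Finset.sum_le_card_nsmul _ _ _ fun i _ => ?_).trans_eq (b :=
      Fintype.card (Fin k → Fin (D.r n)) • ((L + 1 : ENNReal) ^ k *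
        (1 / (D.r (n + (l + 1)) : ENNReal)) ^ k * ENNReal.ofReal (D.width (n + 1) ^ k))) ?_
    · rw [show n + (l + 1) = n + 1 + l by omega]
      exact ih (D.copy_lt hp i)
    · rw [nsmul_eq_mul]
      simp only [Fintype.card_pi, Fintype.card_fin, Finset.prod_const, Finset.card_univ,
        Nat.cast_pow]
      ring

/-- The points of a box whose coordinates are at no stage all in the last copies. -/
def neverAllLast (n : ℕ) (a : Fin k → ℕ) : Set (Fin k → ℝ) :=
  D.box n a \ ⋃ l, D.allLast k (n + l)

theorem exists_mem_reach {n : ℕ} {a : Fin k → ℕ} (ha : ∀ j, 2 * a j < D.height n)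
    {x : Fin k → ℝ} (hx : x ∈ D.neverAllLast n a) (l : ℕ) :
    ∃ p ∈ D.reach n a l, x ∈ D.box (n + l) p := by
  induction l with
  | zero => exact ⟨a, rfl, hx.1⟩
  | succ l ih =>
    obtain ⟨p, hp, hxp⟩ := ih
    have hlt : ∀ j, p j < D.height (n + l) := fun j => by
      have := D.two_mul_lt_of_mem_reach ha hp j
      omega
    obtain ⟨i, hi⟩ := D.exists_copy_box hlt hxp
    refine ⟨_, ⟨p, hp, fun j => i j, fun j => (i j).2, ?_, rfl⟩, hi⟩
    by_contra! hcon
    refine hx.2 (Set.mem_iUnion.2 ⟨l, p, hlt,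
      fun j => ⟨i j + L + 1 - D.r (n + l), by have := (i j).2; omega⟩, ?_⟩)
    have hr := D.lt_r (n + l)
    have e : ∀ j, D.r (n + l) - L - 1 + (i j + L + 1 - D.r (n + l)) = i j := fun j => by
      have := hcon j
      omega
    simpa only [e] using hi

theorem prodMeasure_neverAllLast_ne_zero {n : ℕ} {a : Fin k → ℕ} (ha : ∀ j, a j < D.height n)
    (h : ∑' l, (L + 1 : ENNReal) ^ k * (1 / (D.r (n + l) : ENNReal)) ^ k < 1) :
    D.prodMeasure k (D.neverAllLast n a) ≠ 0 := by
  have hsub : D.neverAllLast n a ⊆ Set.univ.pi fun _ => D.space :=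
    Set.sdiff_subset.trans (D.box_subset_space ha)
  rw [prodMeasure_eq, Measure.restrict_eq_self _ hsub]
  intro h0
  have hbox : D.box n a ⊆ D.neverAllLast n a ∪ ⋃ l, D.box n a ∩ D.allLast k (n + l) := by
    intro x hx
    by_cases hxl : x ∈ ⋃ l, D.allLast k (n + l)
    · exact .inr (by rw [← Set.inter_iUnion]; exact ⟨hx, hxl⟩)
    · exact .inl ⟨hx, hxl⟩
  have hw : 0 < D.width n ^ k := pow_pos (D.width_pos n) k
  have : volume (D.box n a) < volume (D.box n a) := by
    calc volume (D.box n a) ≤ volume (D.neverAllLast n a) +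
          volume (⋃ l, D.box n a ∩ D.allLast k (n + l)) :=
          (measure_mono hbox).trans (measure_union_le _ _)
      _ ≤ ∑' l, (L + 1 : ENNReal) ^ k * (1 / (D.r (n + l) : ENNReal)) ^ k *
          ENNReal.ofReal (D.width n ^ k) := by
        rw [h0, zero_add]
        exact (measure_iUnion_le _).trans
          (ENNReal.tsum_le_tsum fun l => D.volume_box_inter_allLast_le l ha)
      _ < 1 * ENNReal.ofReal (D.width n ^ k) := by
        rw [ENNReal.tsum_mul_right]
        exact ENNReal.mul_lt_mul_left (by simp [hw]) (by simp) h
      _ = volume (D.box n a) := by rw [one_mul, volume_box]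
  exact lt_irrefl _ this

/-! ### The invariant set and failure of ergodicity -/

/-- The points whose levels in column `n + l` differ by a constant from levels in
`D.reach n a l`. -/
def reachStage (n : ℕ) (a : Fin k → ℕ) (l : ℕ) : Set (Fin k → ℝ) :=
  {x | ∃ p : Fin k → ℕ, (∀ j, p j < D.height (n + l)) ∧ x ∈ D.box (n + l) p ∧
    ∃ q ∈ D.reach n a l, ∃ c c', ∀ j, p j + c = q j + c'}

/-- The points that are in `D.reachStage n a l` for all large `l`. -/
def reachSet (n : ℕ) (a : Fin k → ℕ) : Set (Fin k → ℝ) :=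
  {x | ∀ᶠ l in Filter.atTop, x ∈ D.reachStage n a l}

theorem measurableSet_reachSet (n : ℕ) (a : Fin k → ℕ) : MeasurableSet (D.reachSet n a) := by
  have e : ∀ l, D.reachStage n a l = ⋃ p ∈ {p : Fin k → ℕ | (∀ j, p j < D.height (n + l)) ∧
      ∃ q ∈ D.reach n a l, ∃ c c', ∀ j, p j + c = q j + c'}, D.box (n + l) p := by
    intro l
    ext x
    simp only [reachStage, Set.mem_ofPred_eq, Set.mem_iUnion, exists_prop]
    exact exists_congr fun p => by tauto
  have e' : D.reachSet n a = ⋃ N, ⋂ l, ⋂ _ : N ≤ l, D.reachStage n a l := by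
    ext x
    simp only [reachSet, Set.mem_ofPred_eq, Filter.eventually_atTop, Set.mem_iUnion, Set.mem_iInter]
  rw [e']
  refine .iUnion fun N => .iInter fun l => .iInter fun _ => ?_
  rw [e]
  exact .biUnion (Set.to_countable _) fun p _ => D.measurableSet_box _ _

theorem reachSet_subset_space (n : ℕ) (a : Fin k → ℕ) :
    D.reachSet n a ⊆ Set.univ.pi fun _ => D.space := by
  intro x hx
  obtain ⟨l, p, hp, hxp, -⟩ := Filter.Eventually.exists hx
  exact D.box_subset_space hp hxp

/-- Below the top of a column the map raises all levels by one, which the constants absorb; asking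
only for large `l` discards the columns where this fails. -/
theorem preimage_reachSet (n : ℕ) (a : Fin k → ℕ) :
    D.prodT k ⁻¹' D.reachSet n a = D.reachSet n a := by
  ext x
  by_cases hx : ∀ j, x j ∈ D.space
  · refine Filter.eventually_congr ?_
    have hev := (D.eventually_mem_box hx)
    rw [← Filter.map_add_atTop_eq_nat n, Filter.eventually_map] at hev
    filter_upwards [hev] with l hl
    rw [add_comm l n] at hl
    obtain ⟨p, hp, hxp⟩ := hl
    have hTx := D.prodT_mem_box hp hxp
    constructor
    · rintro ⟨p', hp', hxp', q, hq, c, c', h⟩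
      obtain rfl := D.eq_of_mem_box hp' hp hxp' hTx
      refine ⟨p, fun j => by have := hp j; omega, hxp, q, hq, c + 1, c', fun j => ?_⟩
      have : p j + 1 + c = q j + c' := h j
      omega
    · rintro ⟨p', hp', hxp', q, hq, c, c', h⟩
      obtain rfl := D.eq_of_mem_box hp' (fun j => by have := hp j; omega) hxp' hxp
      refine ⟨_, hp, hTx, q, hq, c, c' + 1, fun j => ?_⟩
      have := h j
      omega
  · refine iff_of_false (fun h => hx fun j => ?_) fun h => hx fun j => ?_
    · exact D.T_mem_space_iff.1 (D.reachSet_subset_space n a h j (Set.mem_univ j))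
    · exact D.reachSet_subset_space n a h j (Set.mem_univ j)

theorem neverAllLast_subset_reachSet {n : ℕ} {a : Fin k → ℕ} (ha : ∀ j, 2 * a j < D.height n) :
    D.neverAllLast n a ⊆ D.reachSet n a := by
  refine fun x hx => Filter.Eventually.of_forall fun l => ?_
  obtain ⟨p, hp, hxp⟩ := D.exists_mem_reach ha hx l
  exact ⟨p, fun j => by have := D.two_mul_lt_of_mem_reach ha hp j; omega, hxp, p, hp, 0, 0,
    fun j => rfl⟩

theorem neverAllLast_subset_compl_reachSet {n : ℕ} {a b : Fin k → ℕ}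
    (ha : ∀ j, 2 * a j < D.height n) (hb : ∀ j, 2 * b j < D.height n)
    (hab : ¬ ∃ c c', ∀ j, b j + c = a j + c') :
    D.neverAllLast n b ⊆ (D.reachSet n a)ᶜ := by
  intro x hx hxa
  obtain ⟨l, p, hp, hxp, q, hq, h⟩ := Filter.Eventually.exists hxa
  obtain ⟨p', hp', hxp'⟩ := D.exists_mem_reach hb hx l
  have hlt := fun j => D.two_mul_lt_of_mem_reach hb hp' j
  obtain rfl := D.eq_of_mem_box hp (fun j => by have := hlt j; omega) hxp hxp'
  exact hab (D.diff_const_of_reach hb ha hp' hq h)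

theorem not_ergodic_prodT (hk : 1 < k) (hL : 0 < L)
    (h : ∑' i : ℕ, ((1 : ENNReal) / (D.r i : ENNReal)) ^ k ≠ ⊤) :
    ¬ Ergodic (D.prodT k) (D.prodMeasure k) := by
  intro herg
  have hsum : ∑' i : ℕ, (L + 1 : ENNReal) ^ k * ((1 : ENNReal) / (D.r i : ENNReal)) ^ k ≠ ⊤ := by
    rw [ENNReal.tsum_mul_left]
    exact ENNReal.mul_ne_top (by finiteness) h
  -- Besides a tail sum below one, `n ≥ 1` is needed so that level `1` lies in the lower half;
  -- column `0` has a single level.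
  obtain ⟨n, hn, hn1⟩ := (((ENNReal.tendsto_sum_nat_add _ hsum).eventually_lt_const
    one_pos).and (Filter.eventually_ge_atTop 1)).exists
  simp only [add_comm _ n] at hn
  have hheight : 2 < D.height n := by
    obtain ⟨m, rfl⟩ : ∃ m, n = m + 1 := ⟨n - 1, by omega⟩
    have hr := D.lt_r m
    have := D.two_mul_base_add_le (n := m) (i := 1) (by omega) (D.height_pos m)
    have := D.base_strictMono m one_pos
    omega
  -- The tuples differ in exactly one coordinate, hence not by a constant, as there are at least two
  -- coordinates.
  let a : Fin k → ℕ := fun _ => 0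
  let b : Fin k → ℕ := Pi.single ⟨0, by omega⟩ 1
  have ha : ∀ j, 2 * a j < D.height n := fun j => by simp only [a]; omega
  have hb : ∀ j, 2 * b j < D.height n := fun j => by
    simp only [b, Pi.single_apply]
    split <;> omega
  have hab : ¬ ∃ c c', ∀ j, b j + c = a j + c' := by
    rintro ⟨c, c', h⟩
    have h0 := h ⟨0, by omega⟩
    have h1 := h ⟨1, hk⟩
    simp [a, b] at h0 h1
    omega
  rcases herg.toPreErgodic.measure_self_or_compl_eq_zero (D.measurableSet_reachSet n a)
    (D.preimage_reachSet n a) with h0 | h0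
  · exact D.prodMeasure_neverAllLast_ne_zero (fun j => by have := ha j; omega) hn
      (measure_mono_null (D.neverAllLast_subset_reachSet ha) h0)
  · exact D.prodMeasure_neverAllLast_ne_zero (fun j => by have := hb j; omega) hn
      (measure_mono_null (D.neverAllLast_subset_compl_reachSet ha hb hab) h0)

end VStar

end CuttingStacking

theorem mainTheorem3 (k L : ℕ) (hk : 1 < k) (hkL : k ≤ L) (D : CuttingStacking.VStar L) :
    Ergodic (D.prodT k) (D.prodMeasure k) ↔
      ∑' i : ℕ, ((1 : ENNReal) / (D.r i : ENNReal)) ^ k = ⊤ := by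
  refine ⟨fun h => ?_, D.ergodic_prodT (by omega) hkL⟩
  by_contra hne
  exact D.not_ergodic_prodT hk (by omega) hne h
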